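/- Let $(V,\langle\cdot,\cdot\rangle)$ be $n$-dimensional Minkowski space, $n\ge 1$, i.e. a real vector space with a symmetric bilinear form whose matrix in some basis is $\operatorname{diag}(-1,1,\dots,1)$, and let $T:V\to V$ be linear and self-adjoint, $\langle Tx,y\rangle=\langle x,Ty\rangle$ for all $x,y$. Write $D_k$ for a real diagonal $k\times k$ matrix, $I_k$ for the $k\times k$ identity matrix and $\oplus$ for block sums; eigenvalues of $T$ are those of its complexification. Consider the following normal forms for the pair ($T$, matrix $g$ of $\langle\cdot,\cdot\rangle$) with respect to a common basis of $V$: (a) $T=D_n$, $g=\operatorname{diag}(-1,1,\dots,1)$; (b) $T=\begin{pmatrix}a&b\\-b&a\end{pmatrix}\oplus D_{n-2}$, $g=\begin{pmatrix}1&0\\0&-1\end{pmatrix}\oplus I_{n-2}$, with $a,b\in\mathbb R$, $b\neq0$ (only for $n\ge2$); (c$_2^\varepsilon$), $\varepsilon=\pm1$: $T=\begin{pmatrix}\lambda&1\\0&\lambda\end{pmatrix}\oplus D_{n-2}$, $g=\begin{pmatrix}0&\varepsilon\\\varepsilon&0\end{pmatrix}\oplus I_{n-2}$, with $\lambda\in\mathbb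 R$ (only for $n\ge2$); (c$_3$) $T=\begin{pmatrix}\lambda&1&0\\0&\lambda&1\\0&0&\lambda\end{pmatrix}\oplus D_{n-3}$, $g=\begin{pmatrix}0&0&1\\0&1&0\\1&0&0\end{pmatrix}\oplus I_{n-3}$, with $\lambda\in\mathbb R$ (only for $n\ge3$). Then exactly one of the five types (a), (b), (c$_2^{+1}$), (c$_2^{-1}$), (c$_3$) occurs for $T$. Moreover: - $T$ has form (a) if and only if $T$ is diagonalizable with real spectrum; in this case $T$ has a timelike eigenvector (one with $\langle v,v\rangle<0$). - For real $a$ and $b\ne0$, $T$ has form (b) with these $a,b$ if and only if $a+ib$ is an eigenvalue of $T$. - $T$ has one of the forms (c$_2^{\pm1}$), (c$_3$) if and only if all its eigenvalues are real and $T$ is not diagonalizable; this holds if and only if $T$ has a lightlike eigenvector ($v\ne0$, $\langle v,v\rangle=0$) and it is unique up to scaling. - The parameters of the form are determined by $T$: the diagonal entries of $D_k$ up to order, in (a) also the eigenvalue of the timelike basis vector, in (b) $a$ and $|b|$, and in (c$_2^\varepsilon$) and (c$_3$) $\varepsilon$ and $\lambda$. -/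

import Mathlib

namespace Minkowski

open scoped TensorProduct

variable {V : Type*} [AddCommGroup V] [Module ℝ V]

/-- The matrix `diag(-1, 1, …, 1)`. -/
def metric (n : ℕ) : Matrix (Fin n) (Fin n) ℝ :=
  Matrix.diagonal fun i => if (i : ℕ) = 0 then -1 else 1

/-- `(V, B)` is `n`-dimensional Minkowski space (for `0 < n`): in some basis, `B` is the
standard Minkowski metric `∑_{i ≥ 2} x_i y_i - x_1 y_1`. -/
def IsMinkowski (n : ℕ) (B : LinearMap.BilinForm ℝ V) : Prop :=
  ∃ e : Module.Basis (Fin n) ℝ V, LinearMap.BilinForm.toMatrix e B = metric n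

/-- Some basis of `V` puts the operator `T` in the form `M` and the metric `B` in the form `g`. -/
def HasForm {ι : Type*} [Fintype ι] [DecidableEq ι] (B : LinearMap.BilinForm ℝ V)
    (T : Module.End ℝ V) (M g : Matrix ι ι ℝ) : Prop :=
  ∃ e : Module.Basis ι ℝ V,
    LinearMap.toMatrix e e T = M ∧ LinearMap.BilinForm.toMatrix e B = g

/-- The block diagonal matrix with blocks `A` and `diag(d_1, …, d_m)`. -/
def blockDiag {p m : ℕ} (A : Matrix (Fin p) (Fin p) ℝ) (d : Fin m → ℝ) :
    Matrix (Fin p ⊕ Fin m) (Fin p ⊕ Fin m) ℝ :=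
  Matrix.fromBlocks A 0 0 (Matrix.diagonal d)

/-- `T = D_n`, `g = diag(-1, 1, …, 1)`, where `D_n = diag(d)`. -/
def HasDiagonalForm (n : ℕ) (B : LinearMap.BilinForm ℝ V) (T : Module.End ℝ V)
    (d : Fin n → ℝ) : Prop :=
  HasForm B T (Matrix.diagonal d) (metric n)

/-- `T = (a b; -b a) ⊕ diag(d)`, `g = diag(1, -1) ⊕ I_{n-2}`. The existence of the basis forces
`dim V = 2 + (n - 2)`, so that for `dim V = n` this is only possible if `2 ≤ n`; the same remark
applies to the two following definitions. -/
def HasComplexForm (n : ℕ) (B : LinearMap.BilinForm ℝ V) (T : Module.End ℝ V)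
    (a b : ℝ) (d : Fin (n - 2) → ℝ) : Prop :=
  HasForm B T (blockDiag !![a, b; -b, a] d) (blockDiag !![1, 0; 0, -1] fun _ => 1)

/-- `T = (lam 1; 0 lam) ⊕ diag(d)`, `g = (0 ε; ε 0) ⊕ I_{n-2}`. -/
def HasJordanTwoForm (n : ℕ) (B : LinearMap.BilinForm ℝ V) (T : Module.End ℝ V)
    (ε : ℤˣ) (lam : ℝ) (d : Fin (n - 2) → ℝ) : Prop :=
  HasForm B T (blockDiag !![lam, 1; 0, lam] d)
    (blockDiag !![0, ((ε : ℤ) : ℝ); ((ε : ℤ) : ℝ), 0] fun _ => 1)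

/-- `T = (lam 1 0; 0 lam 1; 0 0 lam) ⊕ diag(d)`, `g = (0 0 1; 0 1 0; 1 0 0) ⊕ I_{n-3}`. -/
def HasJordanThreeForm (n : ℕ) (B : LinearMap.BilinForm ℝ V) (T : Module.End ℝ V)
    (lam : ℝ) (d : Fin (n - 3) → ℝ) : Prop :=
  HasForm B T (blockDiag !![lam, 1, 0; 0, lam, 1; 0, 0, lam] d)
    (blockDiag !![0, 0, 1; 0, 1, 0; 1, 0, 0] fun _ => 1)

/-- The five types of normal forms; `jordanTwo` comes with a sign `ε = ±1`. -/
inductive FormType : Type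
  | diagonal : FormType
  | complex : FormType
  | jordanTwo (ε : ℤˣ) : FormType
  | jordanThree : FormType

/-- `T` and `B` have, in a common basis, a normal form of the given type. -/
def HasNormalForm (n : ℕ) (B : LinearMap.BilinForm ℝ V) (T : Module.End ℝ V) : FormType → Prop
  | .diagonal => ∃ d : Fin n → ℝ, HasDiagonalForm n B T d
  | .complex => ∃ (a b : ℝ) (d : Fin (n - 2) → ℝ), b ≠ 0 ∧ HasComplexForm n B T a b d
  | .jordanTwo ε => ∃ (lam : ℝ) (d : Fin (n - 2) → ℝ), HasJordanTwoForm n B T ε lam d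
  | .jordanThree => ∃ (lam : ℝ) (d : Fin (n - 3) → ℝ), HasJordanThreeForm n B T lam d

/-- `z` is an eigenvalue of (the complexification of) `T`. -/
def IsComplexEigenvalue (T : Module.End ℝ V) (z : ℂ) : Prop :=
  Module.End.HasEigenvalue (LinearMap.baseChange ℂ T : Module.End ℂ (ℂ ⊗[ℝ] V)) z

/-- All complex eigenvalues of `T` are real. -/
def HasRealSpectrum (T : Module.End ℝ V) : Prop :=
  ∀ z : ℂ, IsComplexEigenvalue T z → z.im = 0

/-- `T` is diagonalizable with real spectrum: `V` has a (real) basis of eigenvectors of `T`. -/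
def IsRealDiagonalizable (n : ℕ) (T : Module.End ℝ V) : Prop :=
  ∃ (e : Module.Basis (Fin n) ℝ V) (d : Fin n → ℝ), ∀ i, T (e i) = d i • e i

def IsTimelikeEigenvector (B : LinearMap.BilinForm ℝ V) (T : Module.End ℝ V) (v : V) : Prop :=
  (∃ μ : ℝ, T.HasEigenvector μ v) ∧ B v v < 0

/-- Eigenvectors are nonzero by definition. -/
def IsLightlikeEigenvector (B : LinearMap.BilinForm ℝ V) (T : Module.End ℝ V) (v : V) : Prop :=
  (∃ μ : ℝ, T.HasEigenvector μ v) ∧ B v v = 0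

/-- `T` has a lightlike eigenvector, and it is unique up to scaling. -/
def HasUniqueLightlikeEigendirection (B : LinearMap.BilinForm ℝ V) (T : Module.End ℝ V) : Prop :=
  ∃ v, IsLightlikeEigenvector B T v ∧
    ∀ w, IsLightlikeEigenvector B T w → ∃ c : ℝ, w = c • v

end Minkowski

/-! The position of eigenvectors relative to the light cone decides the type. The basic geometric
fact is `IsMinkowski.eq_smul_of_orthogonal`. It makes the orthogonal complement of an invariant
subspace containing a timelike vector positive definite, so the spectral theorem applies there.
Hence only a small Lorentzian block has to be found (`exists_hasForm_blockDiag`).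

If there is a nonreal eigenvalue, the real and imaginary parts of a normalized eigenvector span the
block; a timelike eigenvector is a block by itself. Otherwise the eigenspaces do not span, and an
eigenvector in the orthogonal complement of their sum is a lightlike `k`. With `N = T - lam`, a
partner `l` of `k` with `N ^ 3 l = 0` generates a Jordan block of size two or three.

Types exclude each other as follows. A nonreal eigenvalue makes all real eigenvectors spacelike. A
timelike eigenvector prevents a unique lightlike eigendirection, which a Jordan chain `y ↦ x`
provides. The number `B x y` is determined up to a positive factor, so its sign (1, -1 or 0)
separates the Jordan types. The remaining parameters are read off the characteristic polynomial. -/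

namespace Minkowski

open scoped TensorProduct

variable {V : Type*} [AddCommGroup V] [Module ℝ V]

/-! ### Causal geometry of Minkowski space -/

theorem IsMinkowski.apply_eq_sum {n : ℕ} {B : LinearMap.BilinForm ℝ V}
    {e : Module.Basis (Fin n) ℝ V} (he : LinearMap.BilinForm.toMatrix e B = metric n) (x y : V) :
    B x y = ∑ i : Fin n, (if (i : ℕ) = 0 then -1 else 1) * (e.repr x i * e.repr y i) := by
  have h : ∀ i j, B (e i) (e j) = metric n i j := fun i j => by
    rw [← he, LinearMap.BilinForm.toMatrix_apply]
  conv_lhs => rw [← e.sum_repr x, ← e.sum_repr y]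
  simp only [map_sum, map_smul, LinearMap.sum_apply, LinearMap.smul_apply, h, metric,
    Matrix.diagonal_apply, smul_eq_mul]
  refine Finset.sum_congr rfl fun i _ => ?_
  simp only [mul_ite, mul_zero, Finset.sum_ite_eq', Finset.mem_univ, if_true]
  split_ifs <;> ring

theorem IsMinkowski.symm {n : ℕ} {B : LinearMap.BilinForm ℝ V} (hB : IsMinkowski n B) (x y : V) :
    B x y = B y x := by
  obtain ⟨e, he⟩ := hB
  simp only [IsMinkowski.apply_eq_sum he, mul_comm]

theorem IsMinkowski.finrank_eq {n : ℕ} {B : LinearMap.BilinForm ℝ V} (hB : IsMinkowski n B) :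
    Module.finrank ℝ V = n := by
  obtain ⟨e, -⟩ := hB
  simp [Module.finrank_eq_card_basis e]

theorem IsMinkowski.finite {n : ℕ} {B : LinearMap.BilinForm ℝ V} (hB : IsMinkowski n B) :
    Module.Finite ℝ V := by
  obtain ⟨e, -⟩ := hB
  exact Module.Finite.of_basis e

/-- All later arguments use the signature of `B` only through this vector `t`. -/
theorem IsMinkowski.exists_timelike {n : ℕ} (hn : 0 < n) {B : LinearMap.BilinForm ℝ V}
    (hB : IsMinkowski n B) :
    ∃ t, B t t < 0 ∧ ∀ x, B t x = 0 → x ≠ 0 → 0 < B x x := by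
  obtain ⟨e, he⟩ := hB
  obtain ⟨m, rfl⟩ : ∃ m, n = m + 1 := ⟨n - 1, by omega⟩
  refine ⟨e 0, ?_, fun x hx hx0 => ?_⟩
  · rw [IsMinkowski.apply_eq_sum he, Fin.sum_univ_succ]
    simp
  · rw [IsMinkowski.apply_eq_sum he, Fin.sum_univ_succ] at hx ⊢
    have h0 : e.repr x 0 = 0 := by simpa using hx
    have hpos : 0 < ∑ i : Fin m, e.repr x i.succ * e.repr x i.succ := by
      refine lt_of_le_of_ne (Finset.sum_nonneg fun i _ => mul_self_nonneg _) fun h => hx0 ?_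
      have := (Finset.sum_eq_zero_iff_of_nonneg fun i _ => mul_self_nonneg _).1 h.symm
      refine e.ext_elem fun i => ?_
      refine Fin.cases (by simpa using h0) (fun j => ?_) i
      simpa using this j (Finset.mem_univ _)
    simpa [h0] using hpos

/-- Two orthogonal vectors which are not spacelike are proportional. -/
theorem IsMinkowski.eq_smul_of_orthogonal {n : ℕ} (hn : 0 < n) {B : LinearMap.BilinForm ℝ V}
    (hB : IsMinkowski n B) {v x : V} (hv0 : v ≠ 0) (hv : B v v ≤ 0) (hvx : B v x = 0)
    (hx : B x x ≤ 0) : ∃ c : ℝ, x = c • v := by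
  obtain ⟨t, -, ht⟩ := hB.exists_timelike hn
  have hxv : B x v = 0 := by rw [hB.symm, hvx]
  have htv : B t v ≠ 0 := fun h => (ht v h hv0).not_ge hv
  -- This combination is orthogonal to `t`, so it is zero or spacelike; as `v ⊥ x` and neither is
  -- spacelike, its square is at most 0.
  have hu : B t v • x - B t x • v = 0 := by
    by_contra h
    have h1 := ht (B t v • x - B t x • v)
      (by simp only [map_sub, map_smul, smul_eq_mul]; ring) h
    simp only [map_sub, map_smul, smul_eq_mul, LinearMap.sub_apply, LinearMap.smul_apply, hvx,
      hxv] at h1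
    nlinarith [mul_nonneg (mul_self_nonneg (B t v)) (neg_nonneg.2 hx),
      mul_nonneg (mul_self_nonneg (B t x)) (neg_nonneg.2 hv)]
  refine ⟨(B t v)⁻¹ * B t x, ?_⟩
  rw [mul_smul, ← sub_eq_zero.1 hu, smul_smul, inv_mul_cancel₀ htv, one_smul]

theorem IsMinkowski.pos_of_orthogonal {n : ℕ} (hn : 0 < n) {B : LinearMap.BilinForm ℝ V}
    (hB : IsMinkowski n B) {v x : V} (hv : B v v < 0) (hvx : B v x = 0) (hx0 : x ≠ 0) :
    0 < B x x := by
  by_contra! hx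
  obtain ⟨c, rfl⟩ := hB.eq_smul_of_orthogonal hn (by rintro rfl; simp at hv) hv.le hvx hx
  have : c = 0 := by simpa [hv.ne] using hvx
  exact hx0 (by simp [this])

theorem IsMinkowski.nondegenerate {n : ℕ} (hn : 0 < n) {B : LinearMap.BilinForm ℝ V}
    (hB : IsMinkowski n B) : B.Nondegenerate := by
  have hsep : ∀ x, (∀ y, B x y = 0) → x = 0 := fun x hx => by
    obtain ⟨t, -, ht⟩ := hB.exists_timelike hn
    by_contra h
    exact (ht x (by rw [hB.symm, hx]) h).ne' (hx x)
  exact ⟨hsep, fun x hx => hsep x fun y => by rw [hB.symm, hx]⟩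

/-! ### Splitting off a Lorentzian block -/

/-- The spectral theorem for a positive definite bilinear form. -/
theorem exists_orthonormal_eigenbasis [FiniteDimensional ℝ V] {m : ℕ}
    (hm : Module.finrank ℝ V = m) (P : LinearMap.BilinForm ℝ V) (hP : ∀ x y, P x y = P y x)
    (hpos : ∀ x, x ≠ 0 → 0 < P x x) (S : Module.End ℝ V) (hS : ∀ x y, P (S x) y = P x (S y)) :
    ∃ (w : Fin m → V) (d : Fin m → ℝ), (∀ i, S (w i) = d i • w i) ∧
      ∀ i j, P (w i) (w j) = if i = j then 1 else 0 := by
  let core : InnerProductSpace.Core ℝ V :=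
    { inner := fun x y => P x y
      conj_inner_symm := fun x y => hP y x
      re_inner_nonneg := fun x => by
        by_cases h : x = 0
        · simp [h]
        · exact (hpos x h).le
      add_left := fun x y z => by simp
      smul_left := fun x y r => by simp
      definite := fun x hx => by
        by_contra h
        exact (hpos x h).ne' hx }
  let _ : NormedAddCommGroup V := core.toNormedAddCommGroup
  let _ : InnerProductSpace ℝ V := InnerProductSpace.ofCore core.toCore
  have hsymm : S.IsSymmetric := fun x y => hS x y
  refine ⟨hsymm.eigenvectorBasis hm, hsymm.eigenvalues hm, fun i =>
    hsymm.apply_eigenvectorBasis hm i, fun i j => ?_⟩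
  exact orthonormal_iff_ite.1 (hsymm.eigenvectorBasis hm).orthonormal i j

theorem linearIndependent_of_gram_det_ne_zero {ι : Type*} [Fintype ι] [DecidableEq ι]
    (B : LinearMap.BilinForm ℝ V) (f : ι → V) (g : Matrix ι ι ℝ)
    (hg : ∀ i j, B (f i) (f j) = g i j) (hdet : g.det ≠ 0) : LinearIndependent ℝ f := by
  rw [Fintype.linearIndependent_iff]
  intro c hc
  have h : g.mulVec c = 0 := by
    ext i
    have : B (f i) (∑ j, c j • f j) = 0 := by rw [hc, map_zero]
    simpa [Matrix.mulVec, dotProduct, hg, mul_comm] using this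
  exact congrFun (Matrix.eq_zero_of_mulVec_eq_zero hdet h)

theorem hasForm_iff {ι : Type*} [Fintype ι] [DecidableEq ι] {B : LinearMap.BilinForm ℝ V}
    {T : Module.End ℝ V} {M g : Matrix ι ι ℝ} : HasForm B T M g ↔ ∃ e : Module.Basis ι ℝ V,
      (∀ j, T (e j) = ∑ i, M i j • e i) ∧ ∀ i j, B (e i) (e j) = g i j := by
  refine exists_congr fun e => and_congr ⟨?_, fun h => ?_⟩ ⟨?_, fun h => ?_⟩
  · rintro rfl j
    conv_lhs => rw [← e.sum_repr (T (e j))]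
    simp [LinearMap.toMatrix_apply]
  · ext i j
    simp [LinearMap.toMatrix_apply, h, Finsupp.single_apply]
  · rintro rfl i j
    rw [LinearMap.BilinForm.toMatrix_apply]
  · ext i j
    rw [LinearMap.BilinForm.toMatrix_apply, h]

theorem det_blockDiag_one_ne_zero {p m : ℕ} {g : Matrix (Fin p) (Fin p) ℝ} (hg : g.det ≠ 0) :
    (blockDiag g fun _ : Fin m => 1).det ≠ 0 := by
  simpa [blockDiag] using hg

/-- A family spanning a `T`-invariant subspace which contains a timelike vector extends, by an
orthonormal eigenbasis of the orthogonal complement, to a basis of `V`. -/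
theorem exists_hasForm_blockDiag {n p : ℕ} (hn : 0 < n) {B : LinearMap.BilinForm ℝ V}
    (hB : IsMinkowski n B) {T : Module.End ℝ V} (hT : LinearMap.IsSelfAdjoint B T)
    (f : Fin p → V) (A g : Matrix (Fin p) (Fin p) ℝ) (hf : ∀ j, T (f j) = ∑ i, A i j • f i)
    (hg : ∀ i j, B (f i) (f j) = g i j) (hdet : g.det ≠ 0) {t : V}
    (ht : t ∈ Submodule.span ℝ (Set.range f)) (htt : B t t < 0) :
    ∃ d : Fin (n - p) → ℝ, HasForm B T (blockDiag A d) (blockDiag g fun _ => 1) := by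
  have := hB.finite
  set F := Submodule.span ℝ (Set.range f) with hF
  set W := B.orthogonal F with hW
  have hli := linearIndependent_of_gram_det_ne_zero B f g hg hdet
  have hrank : Module.finrank ℝ F = p := by simpa using finrank_span_eq_card hli
  -- Ensures `p + (n - p) = n` despite truncated subtraction.
  have hp : p ≤ n := by
    rw [← hrank, ← hB.finrank_eq]
    exact Submodule.finrank_le F
  have hWrank : Module.finrank ℝ W = n - p := by
    rw [LinearMap.BilinForm.finrank_orthogonal (hB.nondegenerate hn), hB.finrank_eq, hrank]
  have hfW : ∀ i, ∀ x ∈ W, B (f i) x = 0 := fun i x hx =>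
    LinearMap.BilinForm.mem_orthogonal_iff.1 hx _ (Submodule.subset_span ⟨i, rfl⟩)
  have hTF : ∀ x ∈ F, T x ∈ F := by
    intro x hx
    induction hx using Submodule.span_induction with
    | mem x h =>
      obtain ⟨j, rfl⟩ := h
      rw [hf]
      exact Submodule.sum_mem _ fun i _ => Submodule.smul_mem _ _ (Submodule.subset_span ⟨i, rfl⟩)
    | zero => simp
    | add x y _ _ hx hy => simpa using Submodule.add_mem _ hx hy
    | smul a x _ hx => simpa using Submodule.smul_mem _ a hx
  have hTW : ∀ x ∈ W, T x ∈ W := fun x hx =>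
    LinearMap.BilinForm.mem_orthogonal_iff.2 fun y hy => by
      rw [← hT y x]
      exact LinearMap.BilinForm.mem_orthogonal_iff.1 hx _ (hTF y hy)
  obtain ⟨w, d, hw, hww⟩ := exists_orthonormal_eigenbasis hWrank (B.restrict W)
    (fun x y => hB.symm _ _)
    (fun x hx => hB.pos_of_orthogonal hn htt
      (LinearMap.BilinForm.mem_orthogonal_iff.1 x.2 _ ht) (by simpa using hx))
    (T.restrict hTW) (fun x y => hT _ _)
  let F' : Fin p ⊕ Fin (n - p) → V := Sum.elim f fun j => w j
  have hgram : ∀ i j, B (F' i) (F' j) = (blockDiag g fun _ => (1 : ℝ)) i j := by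
    rintro (i | i) (j | j)
    · simpa [F', blockDiag] using hg i j
    · simpa [F', blockDiag] using hfW i _ (w j).2
    · simpa [F', blockDiag] using (hB.symm _ _).trans (hfW j _ (w i).2)
    · simpa [F', blockDiag, Matrix.diagonal_apply, Matrix.one_apply] using hww i j
  have hli' := linearIndependent_of_gram_det_ne_zero B F' _ hgram (det_blockDiag_one_ne_zero hdet)
  let e := basisOfLinearIndependentOfCardEqFinrank' F' hli'
    (by simp [hB.finrank_eq]; omega)
  have he : ∀ i, e i = F' i := fun i => by
    simp [e, coe_basisOfLinearIndependentOfCardEqFinrank']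
  refine ⟨d, hasForm_iff.2 ⟨e, ?_, fun i j => by rw [he, he, hgram]⟩⟩
  simp only [he]
  rintro (j | j)
  · simpa [F', blockDiag, Fintype.sum_sum_type] using hf j
  · have : T (w j) = d j • (w j : V) := congrArg Subtype.val (hw j)
    simpa [F', blockDiag, Fintype.sum_sum_type, Matrix.diagonal_apply, ite_smul] using this

/-! ### Nonreal eigenvalues -/

/-- `V → V` induced from an `ℝ`-linear functional on `ℂ`, such as the real or imaginary part. -/
noncomputable def tensorPart (φ : ℂ →ₗ[ℝ] ℝ) : ℂ ⊗[ℝ] V →ₗ[ℝ] V :=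
  (TensorProduct.lid ℝ V).toLinearMap ∘ₗ LinearMap.rTensor V φ

@[simp]
theorem tensorPart_tmul (φ : ℂ →ₗ[ℝ] ℝ) (z : ℂ) (v : V) : tensorPart φ (z ⊗ₜ v) = φ z • v := by
  simp [tensorPart]

theorem tmul_tensorPart_add (u : ℂ ⊗[ℝ] V) :
    (1 : ℂ) ⊗ₜ[ℝ] tensorPart Complex.reLm u + Complex.I ⊗ₜ[ℝ] tensorPart Complex.imLm u = u := by
  induction u using TensorProduct.induction_on with
  | zero => simp
  | tmul z v =>
    rw [tensorPart_tmul, tensorPart_tmul, ← TensorProduct.smul_tmul, ← TensorProduct.smul_tmul,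
      ← TensorProduct.add_tmul]
    congr 1
    apply Complex.ext <;> simp
  | add u w hu hw =>
    conv_rhs => rw [← hu, ← hw]
    simp only [map_add, TensorProduct.tmul_add]
    abel

theorem tensorPart_baseChange (φ : ℂ →ₗ[ℝ] ℝ) (T : Module.End ℝ V) (u : ℂ ⊗[ℝ] V) :
    tensorPart φ (LinearMap.baseChange ℂ T u) = T (tensorPart φ u) := by
  induction u using TensorProduct.induction_on with
  | zero => simp
  | tmul z v => simp
  | add u w hu hw => simp [hu, hw]

theorem tensorPart_re_smul (c : ℂ) (u : ℂ ⊗[ℝ] V) :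
    tensorPart Complex.reLm (c • u) =
      c.re • tensorPart Complex.reLm u - c.im • tensorPart Complex.imLm u := by
  induction u using TensorProduct.induction_on with
  | zero => simp
  | tmul z v => simp [TensorProduct.smul_tmul', sub_smul, mul_smul]
  | add u w hu hw =>
    simp only [smul_add, map_add, hu, hw]
    abel

theorem tensorPart_im_smul (c : ℂ) (u : ℂ ⊗[ℝ] V) :
    tensorPart Complex.imLm (c • u) =
      c.im • tensorPart Complex.reLm u + c.re • tensorPart Complex.imLm u := by
  induction u using TensorProduct.induction_on with
  | zero => simp
  | tmul z v => simp [TensorProduct.smul_tmul', add_smul, mul_smul, add_comm]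
  | add u w hu hw =>
    simp only [smul_add, map_add, hu, hw]
    abel

/-- A complex eigenvalue `a + b i`, in terms of the real and imaginary part of an eigenvector. -/
theorem isComplexEigenvalue_iff (T : Module.End ℝ V) (a b : ℝ) :
    IsComplexEigenvalue T ⟨a, b⟩ ↔
      ∃ x y : V, (x ≠ 0 ∨ y ≠ 0) ∧ T x = a • x - b • y ∧ T y = b • x + a • y := by
  constructor
  · intro h
    obtain ⟨u, hu, hu0⟩ := Module.End.HasEigenvalue.exists_hasEigenvector h
    rw [Module.End.mem_eigenspace_iff] at hu
    refine ⟨tensorPart Complex.reLm u, tensorPart Complex.imLm u, ?_, ?_, ?_⟩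
    · by_contra! hxy
      apply hu0
      rw [← tmul_tensorPart_add u, hxy.1, hxy.2]
      simp
    · rw [← tensorPart_baseChange, hu, tensorPart_re_smul]
    · rw [← tensorPart_baseChange, hu, tensorPart_im_smul]
  · rintro ⟨x, y, hxy, hx, hy⟩
    have hre : tensorPart Complex.reLm ((1 : ℂ) ⊗ₜ[ℝ] x + Complex.I ⊗ₜ[ℝ] y) = x := by simp
    have him : tensorPart Complex.imLm ((1 : ℂ) ⊗ₜ[ℝ] x + Complex.I ⊗ₜ[ℝ] y) = y := by simp
    refine Module.End.hasEigenvalue_of_hasEigenvector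
      (x := (1 : ℂ) ⊗ₜ[ℝ] x + Complex.I ⊗ₜ[ℝ] y) ⟨?_, fun h => ?_⟩
    · rw [Module.End.mem_eigenspace_iff,
        ← tmul_tensorPart_add (LinearMap.baseChange ℂ T _), tensorPart_baseChange,
        tensorPart_baseChange,
        ← tmul_tensorPart_add ((⟨a, b⟩ : ℂ) • _), tensorPart_re_smul, tensorPart_im_smul,
        hre, him, hx, hy]
    · rw [h, map_zero] at hre him
      exact hxy.elim (fun h => h hre.symm) fun h => h him.symm

theorem exists_complexEigenvalue [FiniteDimensional ℝ V] [Nontrivial V] (T : Module.End ℝ V) :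
    ∃ z : ℂ, IsComplexEigenvalue T z := by
  have : Nontrivial (ℂ ⊗[ℝ] V) := by
    obtain ⟨x, hx⟩ := exists_ne (0 : V)
    refine ⟨(1 : ℂ) ⊗ₜ x, 0, fun h => hx ?_⟩
    simpa using congrArg (tensorPart Complex.reLm) h
  exact Module.End.exists_eigenvalue (LinearMap.baseChange ℂ T : Module.End ℂ (ℂ ⊗[ℝ] V))

/-- The real and imaginary part of a complex eigenvector can be chosen orthonormal. -/
theorem exists_orthonormal_complex_pair {n : ℕ} (hn : 0 < n) {B : LinearMap.BilinForm ℝ V}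
    (hB : IsMinkowski n B) {T : Module.End ℝ V} (hT : LinearMap.IsSelfAdjoint B T) {a b : ℝ}
    (hb : b ≠ 0) (h : IsComplexEigenvalue T ⟨a, b⟩) :
    ∃ x y : V, T x = a • x - b • y ∧ T y = b • x + a • y ∧
      B x x = 1 ∧ B y y = -1 ∧ B x y = 0 := by
  obtain ⟨x, y, hxy, hx, hy⟩ := (isComplexEigenvalue_iff T a b).1 h
  have hyx : B y x = B x y := hB.symm _ _
  have hsum : B y y = - B x x := by
    have := hT x y
    simp only [hx, hy, map_sub, map_add, map_smul, LinearMap.sub_apply, LinearMap.smul_apply,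
      smul_eq_mul] at this
    have : b * (B y y + B x x) = 0 := by linarith
    linarith [(mul_eq_zero.1 this).resolve_left hb]
  -- Up to a factor 2 this is the square of `u = x + iy` under the complex bilinear extension of
  -- `B`. If it vanished, `x` and `y` would be orthogonal and lightlike, so `y = c • x`, which
  -- contradicts `b ≠ 0`.
  have hz : (⟨B x x, B x y⟩ : ℂ) ≠ 0 := fun hz => by
    have h1 : B x x = 0 := congrArg Complex.re hz
    have h2 : B x y = 0 := congrArg Complex.im hz
    have hx0 : x ≠ 0 := by
      rintro rfl
      have : y = 0 := by simpa [hb] using hx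
      simp [this] at hxy
    obtain ⟨c, rfl⟩ := hB.eq_smul_of_orthogonal hn hx0 h1.le h2 (by rw [hsum, h1]; simp)
    rw [map_smul, hx] at hy
    have : (b * (1 + c ^ 2)) • x = 0 := by
      have h0 := sub_eq_zero.2 hy
      rw [← neg_eq_zero, ← h0]
      module
    rcases smul_eq_zero.1 this with h | h
    · have : (0 : ℝ) < 1 + c ^ 2 := by positivity
      exact (mul_ne_zero hb this.ne') h
    · exact hx0 h
  -- Replacing `u` by `w u`, with `w` a square root of the inverse, normalizes this number to 1.
  obtain ⟨w, hw⟩ := IsAlgClosed.exists_pow_nat_eq ((⟨B x x, B x y⟩ : ℂ)⁻¹) (n := 2) (by norm_num)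
  have hw' : w * w * ⟨B x x, B x y⟩ = 1 := by rw [← sq, hw, inv_mul_cancel₀ hz]
  have hre := congrArg Complex.re hw'
  have him := congrArg Complex.im hw'
  simp only [Complex.mul_re, Complex.mul_im, Complex.one_re, Complex.one_im] at hre him
  refine ⟨w.re • x - w.im • y, w.im • x + w.re • y, ?_, ?_, ?_, ?_, ?_⟩
  · rw [map_sub, map_smul, map_smul, hx, hy]
    module
  · rw [map_add, map_smul, map_smul, hx, hy]
    module
  all_goals
    simp only [map_sub, map_add, map_smul, LinearMap.sub_apply, LinearMap.add_apply,
      LinearMap.smul_apply, smul_eq_mul, hyx, hsum]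
    linarith

theorem exists_hasComplexForm {n : ℕ} (hn : 0 < n) {B : LinearMap.BilinForm ℝ V}
    (hB : IsMinkowski n B) {T : Module.End ℝ V} (hT : LinearMap.IsSelfAdjoint B T) {a b : ℝ}
    (hb : b ≠ 0) (h : IsComplexEigenvalue T ⟨a, b⟩) :
    ∃ d : Fin (n - 2) → ℝ, HasComplexForm n B T a b d := by
  obtain ⟨x, y, hx, hy, hxx, hyy, hxy⟩ := exists_orthonormal_complex_pair hn hB hT hb h
  refine exists_hasForm_blockDiag hn hB hT ![x, y] _ _ ?_ ?_ ?_ (t := y)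
    (Submodule.subset_span ⟨1, rfl⟩) (by simp [hyy])
  · intro j
    fin_cases j
    · simp [Fin.sum_univ_two, hx, sub_eq_add_neg]
    · simp [Fin.sum_univ_two, hy]
  · intro i j
    fin_cases i <;> fin_cases j <;> simp [hxx, hyy, hxy, hB.symm y x]
  · simp [Matrix.det_fin_two]

/-! ### Timelike and lightlike eigenvectors -/

theorem IsTimelikeEigenvector.hasDiagonalForm {n : ℕ} (hn : 0 < n) {B : LinearMap.BilinForm ℝ V}
    (hB : IsMinkowski n B) {T : Module.End ℝ V} (hT : LinearMap.IsSelfAdjoint B T) {v : V}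
    (hv : IsTimelikeEigenvector B T v) : ∃ d : Fin n → ℝ, HasDiagonalForm n B T d := by
  obtain ⟨⟨μ, hμ⟩, hneg⟩ := hv
  set r := √(-B v v) with hr
  have hr2 : r * r = -B v v := Real.mul_self_sqrt (by linarith)
  have hr0 : r ≠ 0 := fun h => by rw [h] at hr2; linarith
  have hunit : B (r⁻¹ • v) (r⁻¹ • v) = -1 := by
    simp only [map_smul, LinearMap.smul_apply, smul_eq_mul]
    have : B v v = -(r * r) := by linarith
    rw [this]
    field_simp
  obtain ⟨d, hd⟩ := exists_hasForm_blockDiag hn hB hT (fun _ : Fin 1 => r⁻¹ • v)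
    (Matrix.diagonal fun _ => μ) (Matrix.diagonal fun _ => -1) (fun j => by
      have := hμ.apply_eq_smul
      fin_cases j
      simp [this, smul_comm μ]) (fun i j => by
      fin_cases i
      fin_cases j
      simpa using hunit) (by simp) (t := r⁻¹ • v) (Submodule.subset_span ⟨0, rfl⟩)
      (by rw [hunit]; norm_num)
  obtain ⟨e, he, hg⟩ := hasForm_iff.1 hd
  -- The timelike vector must get index 0, where `metric` has its entry -1.
  let σ : Fin 1 ⊕ Fin (n - 1) ≃ Fin n := finSumFinEquiv.trans (finCongr (by omega))
  have hσ : ∀ i, ((σ i : ℕ) = 0 ↔ i = Sum.inl 0) := by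
    rintro (i | i)
    · fin_cases i
      simp [σ]
    · simp [σ]
  have hM : blockDiag (Matrix.diagonal fun _ : Fin 1 => μ) d =
      Matrix.diagonal (Sum.elim (fun _ => μ) d) := by
    simp [blockDiag, Matrix.fromBlocks_diagonal]
  have hG : (blockDiag (Matrix.diagonal fun _ : Fin 1 => (-1 : ℝ)) fun _ : Fin (n - 1) => 1) =
      Matrix.diagonal (Sum.elim (fun _ => (-1 : ℝ)) fun _ => 1) := by
    rw [blockDiag, Matrix.fromBlocks_diagonal]
  rw [hM] at he
  rw [hG] at hg
  refine ⟨Sum.elim (fun _ => μ) d ∘ σ.symm, hasForm_iff.2 ⟨e.reindex σ, fun j => ?_,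
    fun i j => ?_⟩⟩
  · simp [he, Matrix.diagonal_apply, ite_smul]
  · obtain ⟨i, rfl⟩ := σ.surjective i
    obtain ⟨j, rfl⟩ := σ.surjective j
    simp only [Module.Basis.reindex_apply, Equiv.symm_apply_apply, hg, metric,
      Matrix.diagonal_apply, σ.injective.eq_iff, hσ]
    congr 1
    rcases i with i | i
    · simp [Fin.fin_one_eq_zero i]
    · simp

theorem orthogonal_of_eigenvalue_ne {B : LinearMap.BilinForm ℝ V} {T : Module.End ℝ V}
    (hT : LinearMap.IsSelfAdjoint B T) {μ ν : ℝ} (h : μ ≠ ν) {x y : V} (hx : T x = μ • x)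
    (hy : T y = ν • y) : B x y = 0 := by
  have := hT x y
  simp only [hx, hy, map_smul, LinearMap.smul_apply, smul_eq_mul] at this
  have h0 : (μ - ν) * B x y = 0 := by linarith
  exact (mul_eq_zero.1 h0).resolve_left (sub_ne_zero.2 h)

/-- Split a timelike vector into eigenvectors. They are mutually orthogonal, so if none were
timelike the sum could not be. -/
theorem exists_isTimelikeEigenvector {n : ℕ} (hn : 0 < n) {B : LinearMap.BilinForm ℝ V}
    (hB : IsMinkowski n B) {T : Module.End ℝ V} (hT : LinearMap.IsSelfAdjoint B T)
    (h : ⨆ μ : ℝ, T.eigenspace μ = ⊤) : ∃ v, IsTimelikeEigenvector B T v := by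
  obtain ⟨t, ht, -⟩ := hB.exists_timelike hn
  obtain ⟨f, hf, rfl⟩ := (Submodule.mem_iSup_iff_exists_finsupp (fun μ : ℝ => T.eigenspace μ) t).1
    (h ▸ Submodule.mem_top)
  simp only [Module.End.mem_eigenspace_iff] at hf
  by_contra! hno
  refine ht.not_ge ?_
  simp only [Finsupp.sum, map_sum, LinearMap.sum_apply]
  refine Finset.sum_nonneg fun μ _ => Finset.sum_nonneg fun ν _ => ?_
  rcases eq_or_ne μ ν with rfl | hne
  · by_contra! hneg
    refine hno (f μ) ⟨⟨μ, Module.End.mem_eigenspace_iff.2 (hf μ), ?_⟩, hneg⟩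
    intro h0
    simp [h0] at hneg
  · have h0 := orthogonal_of_eigenvalue_ne hT hne (hf μ) (hf ν)
    have h1 := orthogonal_of_eigenvalue_ne hT hne.symm (hf ν) (hf μ)
    rw [h1]

/-- The orthogonal complement of the sum of eigenspaces is nonzero and invariant, so it contains a
real eigenvector. That vector also lies in the sum, hence is orthogonal to itself. -/
theorem exists_isLightlikeEigenvector {n : ℕ} {B : LinearMap.BilinForm ℝ V}
    (hn : 0 < n) (hB : IsMinkowski n B) {T : Module.End ℝ V} (hT : LinearMap.IsSelfAdjoint B T)
    (hreal : HasRealSpectrum T) (h : ⨆ μ : ℝ, T.eigenspace μ ≠ ⊤) :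
    ∃ v, IsLightlikeEigenvector B T v := by
  have := hB.finite
  set E : Submodule ℝ V := ⨆ μ : ℝ, T.eigenspace μ with hE
  set W := B.orthogonal E with hW
  have hTE : ∀ x ∈ E, T x ∈ E := fun x hx => by
    induction hx using Submodule.iSup_induction' with
    | mem μ x hx =>
      rw [Module.End.mem_eigenspace_iff.1 hx]
      exact Submodule.smul_mem _ _ (Submodule.mem_iSup_of_mem μ hx)
    | zero => simp
    | add x y _ _ hx hy => simpa using Submodule.add_mem _ hx hy
  have hTW : ∀ x ∈ W, T x ∈ W := fun x hx =>
    LinearMap.BilinForm.mem_orthogonal_iff.2 fun y hy => by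
      rw [← hT y x]
      exact LinearMap.BilinForm.mem_orthogonal_iff.1 hx _ (hTE y hy)
  have hWnt : Nontrivial W := by
    apply Module.nontrivial_of_finrank_pos (R := ℝ)
    rw [LinearMap.BilinForm.finrank_orthogonal (hB.nondegenerate hn)]
    have := Submodule.finrank_lt h
    omega
  obtain ⟨⟨a, b⟩, hz⟩ := exists_complexEigenvalue (T.restrict hTW)
  obtain ⟨x, y, hxy, hx, hy⟩ := (isComplexEigenvalue_iff _ a b).1 hz
  have hx' : T x = a • (x : V) - b • (y : V) := congrArg Subtype.val hx
  have hy' : T y = b • (x : V) + a • (y : V) := congrArg Subtype.val hy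
  have hb : b = 0 := hreal ⟨a, b⟩ ((isComplexEigenvalue_iff T a b).2
    ⟨x, y, by simpa using hxy, hx', hy'⟩)
  subst hb
  have key : ∀ w : W, w ≠ 0 → T w = a • (w : V) → ∃ v, IsLightlikeEigenvector B T v := by
    intro w hw0 hw
    have hmem : (w : V) ∈ T.eigenspace a := Module.End.mem_eigenspace_iff.2 hw
    exact ⟨w, ⟨a, hmem, by simpa using hw0⟩, LinearMap.BilinForm.mem_orthogonal_iff.1 w.2 _
      (Submodule.mem_iSup_of_mem a hmem)⟩
  rcases hxy with h0 | h0
  · exact key x h0 (by simpa using hx')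
  · exact key y h0 (by simpa using hy')

/-! ### Construction of the Jordan forms -/

/-- The range of `S` is its own double orthogonal, and its orthogonal complement lies in the kernel
of `S`. -/
theorem mem_range_of_ker_le {n : ℕ} (hn : 0 < n) {B : LinearMap.BilinForm ℝ V}
    (hB : IsMinkowski n B) {S : Module.End ℝ V} (hS : LinearMap.IsSelfAdjoint B S) {k : V}
    (h : ∀ x, S x = 0 → B x k = 0) : k ∈ LinearMap.range S := by
  have := hB.finite
  have hrefl : B.IsRefl := fun x y h => by rw [hB.symm, h]
  rw [← LinearMap.BilinForm.orthogonal_orthogonal (hB.nondegenerate hn) hrefl (LinearMap.range S),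
    LinearMap.BilinForm.mem_orthogonal_iff]
  intro x hx
  refine h x ((hB.nondegenerate hn).1 _ fun y => ?_)
  rw [hS, hB.symm]
  exact LinearMap.BilinForm.mem_orthogonal_iff.1 hx _ ⟨y, rfl⟩

theorem isSelfAdjoint_sub_smul {B : LinearMap.BilinForm ℝ V} {T : Module.End ℝ V}
    (hT : LinearMap.IsSelfAdjoint B T) (lam : ℝ) (x y : V) :
    B ((T - lam • (1 : Module.End ℝ V)) x) y = B x ((T - lam • (1 : Module.End ℝ V)) y) := by
  have : B (T x) y = B x (T y) := hT x y
  simp [this]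

/-- A lightlike vector in the kernel of `N` has a lightlike partner in the kernel of `N ^ 3`. -/
theorem exists_lightlike_partner {n : ℕ} (hn : 0 < n) {B : LinearMap.BilinForm ℝ V}
    (hB : IsMinkowski n B) {N : Module.End ℝ V} (hN : ∀ x y, B (N x) y = B x (N y)) {k : V}
    (hk0 : k ≠ 0) (hk : N k = 0) (hkk : B k k = 0) :
    ∃ l, N (N (N l)) = 0 ∧ B k l = 1 ∧ B l l = 0 := by
  -- Otherwise `k = N ^ 3 z`; then `N ^ 2 z` is lightlike or zero and orthogonal to `k`, hence a
  -- multiple of `k`, and `k = N (N ^ 2 z) = 0`.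
  obtain ⟨l, hl, hlk⟩ : ∃ l, N (N (N l)) = 0 ∧ B l k ≠ 0 := by
    by_contra! h
    obtain ⟨z, hz⟩ := mem_range_of_ker_le hn hB (S := N ∘ₗ N ∘ₗ N) (k := k)
      (fun x y => by simp [hN]) (by simpa using h)
    have hz : N (N (N z)) = k := hz
    obtain ⟨c, hc⟩ := hB.eq_smul_of_orthogonal hn hk0 hkk.le (x := N (N z))
      (by rw [← hN, hk]; simp) (by rw [hN, hz, hN, hk]; simp)
    apply hk0
    rw [← hz, hc, map_smul, hk, smul_zero]
  set s := B l k
  have hkl : B k l = s := hB.symm _ _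
  -- The multiple of `k` cancels `B l l` without changing `B k l`.
  refine ⟨s⁻¹ • l - (s⁻¹ * s⁻¹ * B l l / 2) • k, ?_, ?_, ?_⟩
  · simp [hl, hk]
  · simp [hkl, hkk, hlk]
  · simp only [map_sub, map_smul, LinearMap.sub_apply, LinearMap.smul_apply, smul_eq_mul, hkl, hkk,
      show B l k = s from rfl]
    field_simp
    ring

theorem exists_hasJordanThreeForm {n : ℕ} (hn : 0 < n) {B : LinearMap.BilinForm ℝ V}
    (hB : IsMinkowski n B) {T : Module.End ℝ V} (hT : LinearMap.IsSelfAdjoint B T) {lam : ℝ}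
    {x y z : V} (hz : T z = y + lam • z) (hy : T y = x + lam • y) (hx : T x = lam • x)
    (hxx : B x x = 0) (hxy : B x y = 0) (hyy : B y y = 1) (hxz : B x z = 1) (hyz : B y z = 0)
    (hzz : B z z = 0) : ∃ d : Fin (n - 3) → ℝ, HasJordanThreeForm n B T lam d := by
  refine exists_hasForm_blockDiag hn hB hT ![x, y, z] _ _ ?_ ?_ ?_ (t := x - z)
    (Submodule.sub_mem _ (Submodule.subset_span ⟨0, rfl⟩) (Submodule.subset_span ⟨2, rfl⟩))
    (by simp [hxx, hxz, hzz, hB.symm z x])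
  · intro j
    fin_cases j <;> simp [Fin.sum_univ_three, hx, hy, hz]
  · intro i j
    fin_cases i <;> fin_cases j <;>
      simp [hxx, hyy, hzz, hxy, hxz, hyz, hB.symm y x, hB.symm z x, hB.symm z y]
  · simp [Matrix.det_fin_three]

theorem exists_hasJordanTwoForm {n : ℕ} (hn : 0 < n) {B : LinearMap.BilinForm ℝ V}
    (hB : IsMinkowski n B) {T : Module.End ℝ V} (hT : LinearMap.IsSelfAdjoint B T) {lam : ℝ}
    (ε : ℤˣ) {x y : V} (hy : T y = x + lam • y) (hx : T x = lam • x)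
    (hxx : B x x = 0) (hxy : B x y = ((ε : ℤ) : ℝ)) (hyy : B y y = 0) :
    ∃ d : Fin (n - 2) → ℝ, HasJordanTwoForm n B T ε lam d := by
  have hε : ((ε : ℤ) : ℝ) * ((ε : ℤ) : ℝ) = 1 := by
    rcases Int.units_eq_one_or ε with rfl | rfl <;> simp
  refine exists_hasForm_blockDiag hn hB hT ![x, y] _ _ ?_ ?_ ?_ (t := x - ((ε : ℤ) : ℝ) • y)
    (Submodule.sub_mem _ (Submodule.subset_span ⟨0, rfl⟩)
      (Submodule.smul_mem _ _ (Submodule.subset_span ⟨1, rfl⟩)))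
    (by simp [hxx, hxy, hyy, hB.symm y x, hε])
  · intro j
    fin_cases j <;> simp [Fin.sum_univ_two, hx, hy]
  · intro i j
    fin_cases i <;> fin_cases j <;> simp [hxx, hyy, hxy, hB.symm y x]
  · simp [Matrix.det_fin_two]

/-- `N l` is orthogonal to `k`. If `N ^ 2 l = 0`, it is `γ • k`; `γ = 0` would make `k - l` a
timelike eigenvector, and the sign of `γ` is `ε`. If not, `N ^ 2 l = c • k` with `c = B (N l) (N
l)`, positive because a vector orthogonal to `k` is spacelike or a multiple of `k`. -/
theorem IsLightlikeEigenvector.exists_jordanForm {n : ℕ} (hn : 0 < n)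
    {B : LinearMap.BilinForm ℝ V} (hB : IsMinkowski n B) {T : Module.End ℝ V}
    (hT : LinearMap.IsSelfAdjoint B T) {k : V} (hk : IsLightlikeEigenvector B T k)
    (hno : ¬ ∃ v, IsTimelikeEigenvector B T v) :
    (∃ ε : ℤˣ, HasNormalForm n B T (.jordanTwo ε)) ∨ HasNormalForm n B T .jordanThree := by
  obtain ⟨⟨lam, hlam⟩, hkk⟩ := hk
  have hk0 : k ≠ 0 := hlam.2
  set N : Module.End ℝ V := T - lam • (1 : Module.End ℝ V) with hN
  have hTN : ∀ x, T x = N x + lam • x := fun x => by simp [hN]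
  have hNB : ∀ x y, B (N x) y = B x (N y) := isSelfAdjoint_sub_smul hT lam
  have hNk : N k = 0 := by simp [hN, hlam.apply_eq_smul]
  obtain ⟨l, hl3, hkl, hll⟩ := exists_lightlike_partner hn hB hNB hk0 hNk hkk
  have hklN : ∀ x, B k (N x) = 0 := fun x => by rw [← hNB, hNk]; simp
  have hN1 : B (N l) (N (N l)) = 0 := by rw [hNB, hl3, map_zero]
  have hN2 : B (N (N l)) (N (N l)) = 0 := by rw [hNB, hl3, map_zero]
  rcases eq_or_ne (N (N l)) 0 with h2 | h2
  · left
    obtain ⟨γ, hγ⟩ := hB.eq_smul_of_orthogonal hn hk0 hkk.le (hklN l)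
      (by rw [hNB, h2, map_zero])
    have hγ0 : γ ≠ 0 := by
      rintro rfl
      rw [zero_smul] at hγ
      refine hno ⟨k - l, ⟨lam, Module.End.mem_eigenspace_iff.2 ?_, ?_⟩, ?_⟩
      · rw [hTN, map_sub, hNk, hγ]; simp
      · intro h
        have : B k (k - l) = 0 := by rw [h, map_zero]
        simp [hkk, hkl] at this
      · simp [hkk, hkl, hll, hB.symm l k]
    have hr : (√|γ|) * √|γ| = |γ| := Real.mul_self_sqrt (abs_nonneg _)
    have hr0 : √|γ| ≠ 0 := by positivity
    obtain ⟨ε, hε⟩ : ∃ ε : ℤˣ, γ = ((ε : ℤ) : ℝ) * |γ| := by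
      rcases abs_cases γ with ⟨h, -⟩ | ⟨h, -⟩
      · exact ⟨1, by simp [h]⟩
      · exact ⟨-1, by simp [h]⟩
    refine ⟨ε, lam, exists_hasJordanTwoForm hn hB hT ε (x := N ((√|γ|)⁻¹ • l))
      (y := (√|γ|)⁻¹ • l) (hTN _) ?_ ?_ ?_ ?_⟩
    · rw [hTN]; simp [h2]
    · simp [hγ, hkk]
    · simp only [hγ, hkl, map_smul, LinearMap.smul_apply, smul_eq_mul, mul_one]
      rw [← mul_assoc, ← mul_inv, hr]
      nth_rewrite 2 [hε]
      field_simp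
    · simp [hll]
  · right
    obtain ⟨c, hc⟩ := hB.eq_smul_of_orthogonal hn hk0 hkk.le (hklN (N l)) hN2.le
    have hcB : B (N l) (N l) = c := by rw [hNB, hc]; simp [hkl, hB.symm l k]
    have hc0 : c ≠ 0 := by
      rintro rfl
      exact h2 (by rw [hc, zero_smul])
    have hcpos : 0 < c := by
      by_contra! hneg
      obtain ⟨a, ha⟩ := hB.eq_smul_of_orthogonal hn hk0 hkk.le (hklN l) (hcB.le.trans hneg)
      rw [ha] at hcB
      simp [hkk] at hcB
      exact hc0 hcB.symm
    have hlN2 : B l (N (N l)) = c := by rw [← hNB, hcB]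
    have hN2l : B (N (N l)) l = c := by rw [hNB, hcB]
    have hN21 : B (N (N l)) (N l) = 0 := by rw [hB.symm, hN1]
    set β := B l (N l) with hβ
    have hNl : B (N l) l = β := by rw [hNB]
    set r := √c with hrdef
    have hr : r * r = c := Real.mul_self_sqrt hcpos.le
    have hr0 : r ≠ 0 := fun h => by rw [h] at hr; simp at hr; exact hc0 hr.symm
    -- With `u = l + s • N l + t • N (N l)`, `s` solves `B (N u) u = 0` and then `t` solves `B u u =
    -- 0`; dividing by `√c` normalizes `B (N u) (N u)`.
    set s := -β / (2 * c) with hs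
    set t := (-2 * s * β - s * s * c) / (2 * c) with ht
    have hsc : 2 * s * c = -β := by rw [hs]; field_simp
    have htc : 2 * t * c = -2 * s * β - s * s * c := by rw [ht]; field_simp
    set z := r⁻¹ • (l + s • N l + t • N (N l)) with hz
    have hNz : N z = r⁻¹ • (N l + s • N (N l)) := by simp [hz, hl3]
    have hNNz : N (N z) = r⁻¹ • N (N l) := by simp [hNz, hl3]
    refine ⟨lam, exists_hasJordanThreeForm hn hB hT (x := N (N z)) (y := N z) (z := z)
      (hTN _) (hTN _) ?_ ?_ ?_ ?_ ?_ ?_ ?_⟩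
    · rw [hTN, hNNz]; simp [hl3]
    all_goals
      try rw [hNNz]
      try rw [hNz]
      simp only [hz, map_smul, map_add, LinearMap.smul_apply, LinearMap.add_apply,
        smul_eq_mul, hN2, hN1, hN21, hcB, hlN2, hN2l, hNl, hll, ← hβ]
    · ring
    · ring
    · field_simp
      linarith
    · field_simp
      linarith
    · field_simp
      linarith
    · field_simp
      linarith

/-! ### Mutual exclusion of the types -/

theorem IsRealDiagonalizable.iSup_eigenspace {n : ℕ} {T : Module.End ℝ V}
    (h : IsRealDiagonalizable n T) : ⨆ μ : ℝ, T.eigenspace μ = ⊤ := by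
  obtain ⟨e, d, he⟩ := h
  rw [eq_top_iff, ← e.span_eq, Submodule.span_le]
  rintro _ ⟨i, rfl⟩
  exact Submodule.mem_iSup_of_mem (d i) (Module.End.mem_eigenspace_iff.2 (he i))

theorem isRealDiagonalizable_of_hasDiagonalForm {n : ℕ} {B : LinearMap.BilinForm ℝ V}
    {T : Module.End ℝ V} {d : Fin n → ℝ} (h : HasDiagonalForm n B T d) :
    IsRealDiagonalizable n T := by
  obtain ⟨e, he, -⟩ := hasForm_iff.1 h
  exact ⟨e, d, fun i => by simp [he, Matrix.diagonal_apply, ite_smul]⟩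

theorem HasDiagonalForm.exists_timelike {n : ℕ} (hn : 0 < n) {B : LinearMap.BilinForm ℝ V}
    {T : Module.End ℝ V} {d : Fin n → ℝ} (h : HasDiagonalForm n B T d) :
    ∃ v, T v = d ⟨0, hn⟩ • v ∧ B v v < 0 := by
  obtain ⟨e, he, hg⟩ := hasForm_iff.1 h
  exact ⟨e ⟨0, hn⟩, by simp [he, Matrix.diagonal_apply, ite_smul], by simp [hg, metric]⟩

theorem HasComplexForm.isComplexEigenvalue {n : ℕ} {B : LinearMap.BilinForm ℝ V}
    {T : Module.End ℝ V} {a b : ℝ} {d : Fin (n - 2) → ℝ} (h : HasComplexForm n B T a b d) :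
    IsComplexEigenvalue T ⟨a, b⟩ := by
  obtain ⟨e, he, -⟩ := hasForm_iff.1 h
  refine (isComplexEigenvalue_iff T a b).2 ⟨e (Sum.inl 0), e (Sum.inl 1), Or.inl (e.ne_zero _),
    ?_, ?_⟩
  · simp [he, blockDiag, Fintype.sum_sum_type, Fin.sum_univ_two, sub_eq_add_neg]
  · simp [he, blockDiag, Fintype.sum_sum_type, Fin.sum_univ_two]

/-- In the presence of a nonreal eigenvalue, all eigenvectors are spacelike. -/
theorem pos_of_hasEigenvector {n : ℕ} (hn : 0 < n) {B : LinearMap.BilinForm ℝ V}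
    (hB : IsMinkowski n B) {T : Module.End ℝ V} (hT : LinearMap.IsSelfAdjoint B T) {a b : ℝ}
    (hb : b ≠ 0) (h : IsComplexEigenvalue T ⟨a, b⟩) {μ : ℝ} {v : V} (hv : T.HasEigenvector μ v) :
    0 < B v v := by
  obtain ⟨x, y, hx, hy, -, hyy, -⟩ := exists_orthonormal_complex_pair hn hB hT hb h
  have h1 := hT x v
  have h2 := hT y v
  rw [hv.apply_eq_smul] at h1 h2
  simp only [hx, hy, map_sub, map_add, map_smul, LinearMap.sub_apply, LinearMap.add_apply,
    LinearMap.smul_apply, smul_eq_mul] at h1 h2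
  have h3 : (b ^ 2 + (a - μ) ^ 2) * B y v = 0 := by
    linear_combination -b * h1 + (a - μ) * h2
  have h4 : B y v = 0 := (mul_eq_zero.1 h3).resolve_left (by positivity)
  exact hB.pos_of_orthogonal hn (by rw [hyy]; norm_num) h4 hv.2

theorem IsTimelikeEigenvector.not_hasUniqueLightlikeEigendirection {n : ℕ} (hn : 0 < n)
    {B : LinearMap.BilinForm ℝ V} (hB : IsMinkowski n B)
    {T : Module.End ℝ V} (hT : LinearMap.IsSelfAdjoint B T) {u : V}
    (hu : IsTimelikeEigenvector B T u) : ¬ HasUniqueLightlikeEigendirection B T := by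
  rintro ⟨v, ⟨⟨ν, hν⟩, hvv⟩, huniq⟩
  obtain ⟨⟨μ, hμ⟩, huu⟩ := hu
  have huv : B u v ≠ 0 := fun h => (hB.pos_of_orthogonal hn huu h hν.2).ne' hvv
  have hμν : μ = ν := by
    by_contra h
    exact huv (orthogonal_of_eigenvalue_ne hT h hμ.apply_eq_smul hν.apply_eq_smul)
  subst hμν
  have hvu : B v u = B u v := hB.symm _ _
  -- The vector is, up to scale, the reflection of `v` in the hyperplane orthogonal to `u`: a second
  -- lightlike direction in the same eigenspace. The case `c = 0` shows that it is nonzero.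
  have key : ∀ c : ℝ, B u u • v - (2 * B u v) • u ≠ c • v := fun c h => by
    have h1 := congrArg (B v) h
    simp only [map_sub, map_smul, hvv, hvu, smul_eq_mul] at h1
    exact huv (by nlinarith)
  obtain ⟨c, hc⟩ := huniq (B u u • v - (2 * B u v) • u) ⟨⟨μ, Module.End.mem_eigenspace_iff.2 (by
    rw [map_sub, map_smul, map_smul, hμ.apply_eq_smul, hν.apply_eq_smul]
    module), by simpa using key 0⟩, by
    simp only [map_sub, map_smul, LinearMap.sub_apply, LinearMap.smul_apply, smul_eq_mul, hvv, hvu]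
    ring⟩
  exact key c hc

/-- A Jordan chain `y ↦ x` of length two, i.e. `(T - lam) y = x ≠ 0` and `(T - lam) x = 0`. -/
def IsJordanChain (T : Module.End ℝ V) (lam : ℝ) (x y : V) : Prop :=
  x ≠ 0 ∧ T x = lam • x ∧ T y = x + lam • y

/-- `x` lies in the range of the self-adjoint `T - lam`, whose kernel contains `w`. Taking `w = x`
shows that `x` is lightlike. -/
theorem IsJordanChain.apply_eq_zero {B : LinearMap.BilinForm ℝ V} {T : Module.End ℝ V}
    (hT : LinearMap.IsSelfAdjoint B T) {lam : ℝ} {x y : V} (h : IsJordanChain T lam x y) {w : V}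
    (hw : T w = lam • w) : B w x = 0 := by
  have := hT w y
  rw [hw, h.2.2] at this
  simp only [map_add, map_smul, LinearMap.smul_apply, smul_eq_mul] at this
  linarith

theorem IsJordanChain.exists_eq_smul {n : ℕ} (hn : 0 < n) {B : LinearMap.BilinForm ℝ V}
    (hB : IsMinkowski n B) {T : Module.End ℝ V} (hT : LinearMap.IsSelfAdjoint B T) {lam : ℝ}
    {x y : V} (h : IsJordanChain T lam x y) {w : V} (hw : IsLightlikeEigenvector B T w) :
    ∃ c : ℝ, w = c • x := by
  obtain ⟨⟨μ, hμ⟩, hww⟩ := hw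
  refine hB.eq_smul_of_orthogonal hn h.1 (h.apply_eq_zero hT h.2.1).le ?_ hww.le
  rcases eq_or_ne lam μ with rfl | hne
  · rw [hB.symm, h.apply_eq_zero hT hμ.apply_eq_smul]
  · exact orthogonal_of_eigenvalue_ne hT hne h.2.1 hμ.apply_eq_smul

theorem IsJordanChain.isLightlikeEigenvector {B : LinearMap.BilinForm ℝ V} {T : Module.End ℝ V}
    (hT : LinearMap.IsSelfAdjoint B T) {lam : ℝ} {x y : V} (h : IsJordanChain T lam x y) :
    IsLightlikeEigenvector B T x :=
  ⟨⟨lam, Module.End.mem_eigenspace_iff.2 h.2.1, h.1⟩, h.apply_eq_zero hT h.2.1⟩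

theorem IsJordanChain.hasUniqueLightlikeEigendirection {n : ℕ} (hn : 0 < n)
    {B : LinearMap.BilinForm ℝ V} (hB : IsMinkowski n B) {T : Module.End ℝ V}
    (hT : LinearMap.IsSelfAdjoint B T) {lam : ℝ} {x y : V} (h : IsJordanChain T lam x y) :
    HasUniqueLightlikeEigendirection B T :=
  ⟨x, h.isLightlikeEigenvector hT, fun _ hw => h.exists_eq_smul hn hB hT hw⟩

/-- The eigenvalue of a Jordan chain and the sign of the product of its members are unique. -/
theorem IsJordanChain.compare {n : ℕ} (hn : 0 < n) {B : LinearMap.BilinForm ℝ V}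
    (hB : IsMinkowski n B) {T : Module.End ℝ V} (hT : LinearMap.IsSelfAdjoint B T)
    {lam lam' : ℝ} {x y x' y' : V} (h : IsJordanChain T lam x y)
    (h' : IsJordanChain T lam' x' y') :
    lam = lam' ∧ ∃ c : ℝ, c ≠ 0 ∧ B x' y' = c ^ 2 * B x y := by
  obtain ⟨c, rfl⟩ := h.exists_eq_smul hn hB hT (h'.isLightlikeEigenvector hT)
  obtain ⟨hx0, hx', hy'⟩ := h'
  have hc : c ≠ 0 := by
    rintro rfl
    simp at hx0
  have hlam : lam = lam' := by
    rw [map_smul, h.2.1, smul_comm] at hx'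
    exact smul_left_injective ℝ hx0 hx'
  subst hlam
  refine ⟨rfl, c, hc, ?_⟩
  -- Both `y'` and `c • y` are sent to `c • x` by `T - lam`, so the difference is orthogonal to `x`.
  have hw : T (y' - c • y) = lam • (y' - c • y) := by
    rw [map_sub, map_smul, hy', h.2.2]
    module
  have h0 := h.apply_eq_zero hT hw
  rw [hB.symm] at h0
  simp only [map_sub, map_smul, smul_eq_mul, LinearMap.smul_apply] at h0 ⊢
  linear_combination c * h0

theorem HasJordanTwoForm.exists_isJordanChain {n : ℕ} {B : LinearMap.BilinForm ℝ V}
    {T : Module.End ℝ V} {ε : ℤˣ} {lam : ℝ} {d : Fin (n - 2) → ℝ}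
    (h : HasJordanTwoForm n B T ε lam d) :
    ∃ x y, IsJordanChain T lam x y ∧ B x y = ((ε : ℤ) : ℝ) := by
  obtain ⟨e, he, hg⟩ := hasForm_iff.1 h
  refine ⟨e (Sum.inl 0), e (Sum.inl 1), ⟨e.ne_zero _, ?_, ?_⟩, ?_⟩
  · simp [he, blockDiag, Fintype.sum_sum_type, Fin.sum_univ_two]
  · simp [he, blockDiag, Fintype.sum_sum_type, Fin.sum_univ_two]
  · simp [hg, blockDiag]

/-- The first two basis vectors suffice: `B x y = 0`, instead of `±1`, tells this type from the
blocks of size two. -/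
theorem HasJordanThreeForm.exists_isJordanChain {n : ℕ} {B : LinearMap.BilinForm ℝ V}
    {T : Module.End ℝ V} {lam : ℝ} {d : Fin (n - 3) → ℝ} (h : HasJordanThreeForm n B T lam d) :
    ∃ x y, IsJordanChain T lam x y ∧ B x y = 0 := by
  obtain ⟨e, he, hg⟩ := hasForm_iff.1 h
  refine ⟨e (Sum.inl 0), e (Sum.inl 1), ⟨e.ne_zero _, ?_, ?_⟩, ?_⟩
  · simp [he, blockDiag, Fintype.sum_sum_type, Fin.sum_univ_three]
  · simp [he, blockDiag, Fintype.sum_sum_type, Fin.sum_univ_three]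
  · simp [hg, blockDiag]

/-! ### Characteristic polynomials and uniqueness of parameters -/

/-- The multisets of roots agree, so both tuples have the same sorted form; `σ` undoes one sorting
and applies the other. -/
theorem exists_perm_of_prod_X_sub_C_eq {m : ℕ} {d d' : Fin m → ℝ}
    (h : ∏ i, (Polynomial.X - Polynomial.C (d i)) = ∏ i, (Polynomial.X - Polynomial.C (d' i))) :
    ∃ σ : Equiv.Perm (Fin m), d' = d ∘ σ := by
  have hroots : ∀ f : Fin m → ℝ, (∏ i, (Polynomial.X - Polynomial.C (f i))).roots =
      Finset.univ.val.map f := fun f => by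
    rw [← Polynomial.roots_multiset_prod_X_sub_C (Finset.univ.val.map f), Multiset.map_map]
    rfl
  have hmap : Finset.univ.val.map d = Finset.univ.val.map d' := by rw [← hroots, h, hroots]
  rw [Fin.univ_val_map, Fin.univ_val_map, Multiset.coe_eq_coe] at hmap
  have hperm : (List.ofFn (d ∘ Tuple.sort d)).Perm (List.ofFn (d' ∘ Tuple.sort d')) :=
    ((Tuple.sort d).ofFn_comp_perm d).trans (hmap.trans ((Tuple.sort d').ofFn_comp_perm d').symm)
  have hsort : d ∘ Tuple.sort d = d' ∘ Tuple.sort d' := List.ofFn_injective <|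
    hperm.eq_of_sortedLE (List.sortedLE_ofFn_iff.2 (Tuple.monotone_sort d))
      (List.sortedLE_ofFn_iff.2 (Tuple.monotone_sort d'))
  refine ⟨(Tuple.sort d').symm.trans (Tuple.sort d), funext fun i => ?_⟩
  simpa using (congrFun hsort ((Tuple.sort d').symm i)).symm

theorem HasForm.charpoly_eq [Module.Finite ℝ V] {ι : Type*} [Fintype ι] [DecidableEq ι]
    {B : LinearMap.BilinForm ℝ V} {T : Module.End ℝ V} {M g : Matrix ι ι ℝ}
    (h : HasForm B T M g) : T.charpoly = M.charpoly := by
  obtain ⟨e, rfl, -⟩ := h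
  rw [LinearMap.charpoly_toMatrix]

theorem charpoly_blockDiag {p m : ℕ} (A : Matrix (Fin p) (Fin p) ℝ) (d : Fin m → ℝ) :
    (blockDiag A d).charpoly = A.charpoly * ∏ i, (Polynomial.X - Polynomial.C (d i)) := by
  rw [blockDiag, Matrix.charpoly_fromBlocks_zero₂₁, Matrix.charpoly_diagonal]

theorem HasForm.exists_perm [Module.Finite ℝ V] {p m : ℕ} {B : LinearMap.BilinForm ℝ V}
    {T : Module.End ℝ V} {A A' g g' : Matrix (Fin p) (Fin p) ℝ} {d d' : Fin m → ℝ}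
    (hA : A.charpoly = A'.charpoly)
    (h : HasForm B T (blockDiag A d) (blockDiag g fun _ => 1))
    (h' : HasForm B T (blockDiag A' d') (blockDiag g' fun _ => 1)) :
    ∃ σ : Equiv.Perm (Fin m), d' = d ∘ σ := by
  refine exists_perm_of_prod_X_sub_C_eq (mul_left_cancel₀ (Matrix.charpoly_monic A).ne_zero ?_)
  rw [← charpoly_blockDiag, ← h.charpoly_eq, h'.charpoly_eq, charpoly_blockDiag, hA]

theorem charpoly_complexBlock (a b : ℝ) :
    (!![a, b; -b, a] : Matrix (Fin 2) (Fin 2) ℝ).charpoly =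
      (Polynomial.X - Polynomial.C a) ^ 2 + Polynomial.C (b ^ 2) := by
  rw [Matrix.charpoly_fin_two]
  simp [Matrix.trace_fin_two, Matrix.det_fin_two]
  ring

/-- A nonreal eigenvalue of `T` is one of those of the first block of a complex form. -/
theorem HasComplexForm.eq_of_hasComplexForm [Module.Finite ℝ V] {n : ℕ}
    {B : LinearMap.BilinForm ℝ V} {T : Module.End ℝ V} {a b a' b' : ℝ} {d d' : Fin (n - 2) → ℝ}
    (hb' : b' ≠ 0) (h : HasComplexForm n B T a b d)
    (h' : HasComplexForm n B T a' b' d') : a = a' ∧ |b| = |b'| := by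
  have hpoly := (HasForm.charpoly_eq h).symm.trans (HasForm.charpoly_eq h')
  rw [charpoly_blockDiag, charpoly_blockDiag, charpoly_complexBlock, charpoly_complexBlock] at hpoly
  -- At `a' + ib'` the right side vanishes. The real linear factors on the left do not, as `b' ≠ 0`,
  -- so the quadratic one does.
  have hev := congrArg (Polynomial.aeval (⟨a', b'⟩ : ℂ)) hpoly
  have hroot : ((⟨a', b'⟩ : ℂ) - a') ^ 2 + (b' : ℂ) ^ 2 = 0 := by
    apply Complex.ext <;> simp [sq]
  simp only [map_mul, map_add, map_pow, map_sub, Polynomial.aeval_X, Polynomial.aeval_C,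
    map_prod, Complex.coe_algebraMap, hroot, zero_mul, mul_eq_zero,
    Finset.prod_eq_zero_iff] at hev
  rcases hev with hev | ⟨i, -, hi⟩
  · have hre := congrArg Complex.re hev
    have him := congrArg Complex.im hev
    simp [sq] at hre him
    have ha : a = a' := by
      have : b' * (a' - a) = 0 := by linarith
      linarith [(mul_eq_zero.1 this).resolve_left hb']
    subst ha
    refine ⟨rfl, (sq_eq_sq_iff_abs_eq_abs b b').1 ?_⟩
    nlinarith
  · have him := congrArg Complex.im hi
    simp at him
    exact absurd him hb'

end Minkowski

/-! ### Assembly -/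

theorem mainTheorem4 {V : Type*} [AddCommGroup V] [Module ℝ V] (n : ℕ) (hn : 0 < n)
    (B : LinearMap.BilinForm ℝ V) (hB : Minkowski.IsMinkowski n B)
    (T : Module.End ℝ V) (hT : LinearMap.IsSelfAdjoint B T) :
    -- exactly one type of normal form
    (∃! τ : Minkowski.FormType, Minkowski.HasNormalForm n B T τ) ∧
    -- (a) diagonalizable with real spectrum
    (Minkowski.IsRealDiagonalizable n T ↔ Minkowski.HasNormalForm n B T .diagonal) ∧
    (Minkowski.IsRealDiagonalizable n T → ∃ v, Minkowski.IsTimelikeEigenvector B T v) ∧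
    -- (b) a complex eigenvalue `a + b i` with `b ≠ 0`
    (∀ a b : ℝ, b ≠ 0 → (Minkowski.IsComplexEigenvalue T (⟨a, b⟩ : ℂ) ↔
      ∃ d : Fin (n - 2) → ℝ, Minkowski.HasComplexForm n B T a b d)) ∧
    -- (c) real eigenvalues, but not diagonalizable
    (Minkowski.HasRealSpectrum T ∧ ¬ Minkowski.IsRealDiagonalizable n T ↔
      (∃ ε : ℤˣ, Minkowski.HasNormalForm n B T (.jordanTwo ε)) ∨
        Minkowski.HasNormalForm n B T .jordanThree) ∧
    (Minkowski.HasRealSpectrum T ∧ ¬ Minkowski.IsRealDiagonalizable n T ↔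
      Minkowski.HasUniqueLightlikeEigendirection B T) ∧
    -- the parameters of the normal form are unique, up to the order of the diagonal entries
    -- (and, in case (b), the sign of `b`)
    (∀ d d' : Fin n → ℝ, Minkowski.HasDiagonalForm n B T d → Minkowski.HasDiagonalForm n B T d' →
      d ⟨0, hn⟩ = d' ⟨0, hn⟩ ∧ ∃ σ : Equiv.Perm (Fin n), d' = d ∘ σ) ∧
    (∀ (a b a' b' : ℝ) (d d' : Fin (n - 2) → ℝ), b ≠ 0 → b' ≠ 0 →
      Minkowski.HasComplexForm n B T a b d → Minkowski.HasComplexForm n B T a' b' d' →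
      a = a' ∧ |b| = |b'| ∧ ∃ σ : Equiv.Perm (Fin (n - 2)), d' = d ∘ σ) ∧
    (∀ (ε ε' : ℤˣ) (lam lam' : ℝ) (d d' : Fin (n - 2) → ℝ),
      Minkowski.HasJordanTwoForm n B T ε lam d → Minkowski.HasJordanTwoForm n B T ε' lam' d' →
      ε = ε' ∧ lam = lam' ∧ ∃ σ : Equiv.Perm (Fin (n - 2)), d' = d ∘ σ) ∧
    (∀ (lam lam' : ℝ) (d d' : Fin (n - 3) → ℝ),
      Minkowski.HasJordanThreeForm n B T lam d → Minkowski.HasJordanThreeForm n B T lam' d' →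
      lam = lam' ∧ ∃ σ : Equiv.Perm (Fin (n - 3)), d' = d ∘ σ) := by
  have hfin := hB.finite
  have hdiag : Minkowski.IsRealDiagonalizable n T → ∃ v, Minkowski.IsTimelikeEigenvector B T v :=
    fun h => Minkowski.exists_isTimelikeEigenvector hn hB hT h.iSup_eigenspace
  have hform : Minkowski.HasNormalForm n B T .diagonal → Minkowski.IsRealDiagonalizable n T :=
    fun ⟨_, hd⟩ => Minkowski.isRealDiagonalizable_of_hasDiagonalForm hd
  have hcomplex : ∀ a b : ℝ, b ≠ 0 → Minkowski.IsComplexEigenvalue T (⟨a, b⟩ : ℂ) →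
      ∀ v, Minkowski.IsTimelikeEigenvector B T v ∨ Minkowski.IsLightlikeEigenvector B T v →
        False := by
    rintro a b hb h v (⟨⟨μ, hμ⟩, hv⟩ | ⟨⟨μ, hμ⟩, hv⟩)
    · exact (Minkowski.pos_of_hasEigenvector hn hB hT hb h hμ).not_gt hv
    · exact (Minkowski.pos_of_hasEigenvector hn hB hT hb h hμ).ne' hv
  have hjordan : ((∃ ε : ℤˣ, Minkowski.HasNormalForm n B T (.jordanTwo ε)) ∨
      Minkowski.HasNormalForm n B T .jordanThree) →
      Minkowski.HasUniqueLightlikeEigendirection B T := by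
    rintro (⟨ε, lam, d, h⟩ | ⟨lam, d, h⟩)
    · obtain ⟨x, y, hxy, -⟩ := h.exists_isJordanChain
      exact hxy.hasUniqueLightlikeEigendirection hn hB hT
    · obtain ⟨x, y, hxy, -⟩ := h.exists_isJordanChain
      exact hxy.hasUniqueLightlikeEigendirection hn hB hT
  have hunique : Minkowski.HasUniqueLightlikeEigendirection B T →
      Minkowski.HasRealSpectrum T ∧ ¬ Minkowski.IsRealDiagonalizable n T := by
    refine fun h => ⟨fun z hz => ?_, fun hd => ?_⟩
    · by_contra hb
      obtain ⟨v, hv, -⟩ := h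
      exact hcomplex z.re z.im hb hz v (Or.inr hv)
    · obtain ⟨u, hu⟩ := hdiag hd
      exact hu.not_hasUniqueLightlikeEigendirection hn hB hT h
  have hreal : Minkowski.HasRealSpectrum T → Minkowski.HasNormalForm n B T .diagonal ∨
      ((∃ ε : ℤˣ, Minkowski.HasNormalForm n B T (.jordanTwo ε)) ∨
        Minkowski.HasNormalForm n B T .jordanThree) := by
    intro h
    by_cases ht : ∃ v, Minkowski.IsTimelikeEigenvector B T v
    · obtain ⟨v, hv⟩ := ht
      exact Or.inl (hv.hasDiagonalForm hn hB hT)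
    · obtain ⟨k, hk⟩ := Minkowski.exists_isLightlikeEigenvector hn hB hT h
        fun htop => ht (Minkowski.exists_isTimelikeEigenvector hn hB hT htop)
      exact Or.inr (hk.exists_jordanForm hn hB hT ht)
  have hjordanTwo : ∀ (ε ε' : ℤˣ) (lam lam' : ℝ) (d d' : Fin (n - 2) → ℝ),
      Minkowski.HasJordanTwoForm n B T ε lam d → Minkowski.HasJordanTwoForm n B T ε' lam' d' →
      ε = ε' ∧ lam = lam' := by
    intro ε ε' lam lam' d d' h h'
    obtain ⟨x, y, hxy, hε⟩ := h.exists_isJordanChain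
    obtain ⟨x', y', hxy', hε'⟩ := h'.exists_isJordanChain
    obtain ⟨hlam, c, hc, hcc⟩ := hxy.compare hn hB hT hxy'
    have hc2 : 0 < c ^ 2 := by positivity
    refine ⟨?_, hlam⟩
    -- Now `ε' = c ^ 2 * ε` with `c ^ 2 > 0`, so opposite signs are impossible.
    rw [hε, hε'] at hcc
    rcases Int.units_eq_one_or ε with rfl | rfl <;> rcases Int.units_eq_one_or ε' with rfl | rfl
    · rfl
    · norm_num at hcc
      linarith
    · norm_num at hcc
      linarith
    · rfl
  have hnotBoth : ∀ ε : ℤˣ, Minkowski.HasNormalForm n B T (.jordanTwo ε) →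
      ¬ Minkowski.HasNormalForm n B T .jordanThree := by
    rintro ε ⟨lam, d, h⟩ ⟨lam', d', h'⟩
    obtain ⟨x, y, hxy, hε⟩ := h.exists_isJordanChain
    obtain ⟨x', y', hxy', h0⟩ := h'.exists_isJordanChain
    obtain ⟨-, c, hc, hcc⟩ := hxy.compare hn hB hT hxy'
    rw [hε, h0] at hcc
    refine pow_ne_zero 2 hc ?_
    rcases Int.units_eq_one_or ε with rfl | rfl <;> simpa using hcc.symm
  have hdiagNotComplex : Minkowski.HasNormalForm n B T .diagonal →
      ¬ Minkowski.HasNormalForm n B T .complex := by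
    rintro hd ⟨a, b, d, hb, h⟩
    obtain ⟨u, hu⟩ := hdiag (hform hd)
    exact hcomplex a b hb h.isComplexEigenvalue u (Or.inl hu)
  have hnotComplex : Minkowski.HasUniqueLightlikeEigendirection B T →
      ¬ Minkowski.HasNormalForm n B T .complex := by
    rintro ⟨v, hv, -⟩ ⟨a, b, d, hb, h⟩
    exact hcomplex a b hb h.isComplexEigenvalue v (Or.inr hv)
  have hnotDiag : Minkowski.HasUniqueLightlikeEigendirection B T →
      ¬ Minkowski.HasNormalForm n B T .diagonal := fun h hd => (hunique h).2 (hform hd)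
  have hat_most_one : ∀ τ τ', Minkowski.HasNormalForm n B T τ →
      Minkowski.HasNormalForm n B T τ' → τ' = τ := by
    rintro (_ | _ | ε | _) (_ | _ | ε' | _) h h'
    · rfl
    · exact absurd h' (hdiagNotComplex h)
    · exact absurd h (hnotDiag (hjordan (Or.inl ⟨ε', h'⟩)))
    · exact absurd h (hnotDiag (hjordan (Or.inr h')))
    · exact absurd h (hdiagNotComplex h')
    · rfl
    · exact absurd h (hnotComplex (hjordan (Or.inl ⟨ε', h'⟩)))
    · exact absurd h (hnotComplex (hjordan (Or.inr h')))
    · exact absurd h' (hnotDiag (hjordan (Or.inl ⟨ε, h⟩)))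
    · exact absurd h' (hnotComplex (hjordan (Or.inl ⟨ε, h⟩)))
    · obtain ⟨lam, d, h⟩ := h
      obtain ⟨lam', d', h'⟩ := h'
      rw [(hjordanTwo _ _ _ _ _ _ h h').1]
    · exact absurd h' (hnotBoth ε h)
    · exact absurd h' (hnotDiag (hjordan (Or.inr h)))
    · exact absurd h' (hnotComplex (hjordan (Or.inr h)))
    · exact absurd h (hnotBoth ε' h')
    · rfl
  have hexists : ∃ τ, Minkowski.HasNormalForm n B T τ := by
    by_cases h : Minkowski.HasRealSpectrum T
    · rcases hreal h with h | ⟨ε, h⟩ | h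
      exacts [⟨_, h⟩, ⟨_, h⟩, ⟨_, h⟩]
    · simp only [Minkowski.HasRealSpectrum, not_forall] at h
      obtain ⟨z, hz, hb⟩ := h
      obtain ⟨d, hd⟩ := Minkowski.exists_hasComplexForm hn hB hT hb hz
      exact ⟨.complex, z.re, z.im, d, hb, hd⟩
  refine ⟨?_, ⟨fun h => ?_, hform⟩, hdiag, ?_, ⟨fun h => ?_, fun h => hunique (hjordan h)⟩,
    ⟨fun h => hjordan ((hreal h.1).resolve_left fun hd => h.2 (hform hd)), hunique⟩, ?_, ?_, ?_, ?_⟩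
  · obtain ⟨τ, hτ⟩ := hexists
    exact ⟨τ, hτ, fun τ' hτ' => hat_most_one τ τ' hτ hτ'⟩
  · obtain ⟨v, hv⟩ := hdiag h
    exact hv.hasDiagonalForm hn hB hT
  · exact fun a b hb => ⟨Minkowski.exists_hasComplexForm hn hB hT hb,
      fun ⟨_, h⟩ => h.isComplexEigenvalue⟩
  · exact (hreal h.1).resolve_left fun hd => h.2 (hform hd)
  · intro d d' h h'
    constructor
    · obtain ⟨u, hu, huu⟩ := h.exists_timelike hn
      obtain ⟨u', hu', huu'⟩ := h'.exists_timelike hn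
      -- Distinct eigenvalues would make two timelike vectors orthogonal.
      by_contra hne
      have h0 := Minkowski.orthogonal_of_eigenvalue_ne hT hne hu hu'
      exact (hB.pos_of_orthogonal hn huu h0 (by rintro rfl; simp at huu')).not_gt huu'
    · refine Minkowski.exists_perm_of_prod_X_sub_C_eq ?_
      rw [← Matrix.charpoly_diagonal, ← Matrix.charpoly_diagonal, ← Minkowski.HasForm.charpoly_eq h,
        Minkowski.HasForm.charpoly_eq h']
  · intro a b a' b' d d' hb hb' h h'
    obtain ⟨rfl, hbb⟩ := h.eq_of_hasComplexForm hb' h'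
    refine ⟨rfl, hbb, Minkowski.HasForm.exists_perm ?_ h h'⟩
    rw [Minkowski.charpoly_complexBlock, Minkowski.charpoly_complexBlock, ← sq_abs b, hbb, sq_abs]
  · intro ε ε' lam lam' d d' h h'
    obtain ⟨rfl, rfl⟩ := hjordanTwo ε ε' lam lam' d d' h h'
    exact ⟨rfl, rfl, Minkowski.HasForm.exists_perm rfl h h'⟩
  · intro lam lam' d d' h h'
    obtain ⟨x, y, hxy, -⟩ := h.exists_isJordanChain
    obtain ⟨x', y', hxy', -⟩ := h'.exists_isJordanChain
    obtain ⟨rfl, -⟩ := hxy.compare hn hB hT hxy'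
    exact ⟨rfl, Minkowski.HasForm.exists_perm rfl h h'⟩
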